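/- All rings are commutative, unital and Noetherian, and modules are over such rings. Let $(R,\mathfrak m)$ be a local ring. Its depth is the common length of the maximal $R$-regular sequences in $\mathfrak m$, and $R$ is Cohen–Macaulay if $\operatorname{depth} R=\dim R$. An ideal $I$ of a local ring $(S,\mathfrak n)$ is a Burch ideal if $\mathfrak n I\neq \mathfrak n(I:_S\mathfrak n)$. A local ring $R$ of depth $t$, with $\mathfrak m$-adic completion $\widehat R$, is a Burch ring if there exist a maximal $\widehat R$-regular sequence $x_1,\dots,x_t$ in $\widehat R$, a regular local ring $S$ and a Burch ideal $I$ of $S$ such that $\widehat R/(x_1,\dots,x_t)\cong S/I$ as rings. **Theorem** (the Auslander–Reiten conjecture holds for Cohen–Macaulay Burch rings). Let $R$ be a Cohen–Macaulay local ring which is a Burch ring, and let $M$ be a finitely generated $R$-module such that $\operatorname{Ext}^j_R(M,M)=0$ and $\operatorname{Ext}^j_R(M,R)=0$ for all $j>0$. Then $M$ is free. -/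

import Mathlib

universe u

open IsLocalRing

/-- The depth of a local ring `R`: the supremum of the lengths of the `R`-regular sequences
contained in the maximal ideal. -/
noncomputable def localRingDepth (R : Type u) [CommRing R] [IsLocalRing R] : ℕ∞ :=
  ⨆ (rs : List R) (_ : RingTheory.Sequence.IsRegular R rs ∧ ∀ r ∈ rs, r ∈ maximalIdeal R),
    (rs.length : ℕ∞)

/-- A Noetherian local ring is Cohen-Macaulay if its depth equals its Krull dimension. -/
def IsCohenMacaulayLocal (R : Type u) [CommRing R] [IsLocalRing R] [IsNoetherianRing R] : Prop :=
  (localRingDepth R : WithBot ℕ∞) = ringKrullDim R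

/-- An ideal `I` of a local ring `(S, 𝔫)` is a Burch ideal if `𝔫 I ≠ 𝔫 (I : 𝔫)`. -/
def IsBurchIdeal {S : Type u} [CommRing S] [IsLocalRing S] (I : Ideal S) : Prop :=
  maximalIdeal S * I ≠ maximalIdeal S * Submodule.colon I (maximalIdeal S : Set S)

/-- A finite sequence is a maximal `A`-regular sequence (in the local ring `A`) if it is an
`A`-regular sequence in the maximal ideal that cannot be extended to a longer one. -/
structure IsMaximalRegularSequence {A : Type u} [CommRing A] [IsLocalRing A]
    (rs : List A) : Prop where
  isRegular : RingTheory.Sequence.IsRegular A rs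
  mem_maximalIdeal : ∀ r ∈ rs, r ∈ maximalIdeal A
  not_extend : ∀ y ∈ maximalIdeal A, ¬ RingTheory.Sequence.IsRegular A (rs ++ [y])

/-- A Noetherian local ring `R` of depth `t` is a Burch ring if its `𝔪`-adic completion has a
maximal regular sequence `x₁, …, x_t` such that the quotient by it is isomorphic to `S / I` with
`S` a regular local ring and `I` a Burch ideal of `S`. (Such an `S` has the same residue field as
`R`, so taking `S` in the universe of `R` is no restriction.) -/
def IsBurchRing (R : Type u) [CommRing R] [IsLocalRing R] [IsNoetherianRing R] : Prop :=
  ∃ rs : List (AdicCompletion (maximalIdeal R) R),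
    (rs.length : ℕ∞) = localRingDepth R ∧
    IsMaximalRegularSequence rs ∧
    ∃ (S : Type u) (_ : CommRing S) (_ : IsRegularLocalRing S) (I : Ideal S),
      IsBurchIdeal I ∧
      Nonempty ((AdicCompletion (maximalIdeal R) R ⧸ Ideal.ofList rs) ≃+* (S ⧸ I))

/-! Let `F` be the minimal free resolution of `M` and let `N` be `M` or the ring. The vanishing of
`Ext^j(M, N)` for all `j > 0` is the exactness of `Hom(F, N)` in positive degrees. It passes to the
completion by flatness, and to the quotient by a regular element of the maximal ideal once `M` is
replaced by its first syzygy, on which the element is again regular. This reduces the claim to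
`A = S/I` with `I` a Burch ideal of the local ring `(S, 𝔫)`.

There choose `x ∈ 𝔫` and `y ∈ (I : 𝔫)` with `xy ∉ 𝔫I`. If `F₁` and `F₄` are nonzero, the second
syzygy `Z ⊆ F₁` of `M` contains the socle element `c = y e` with `e` a basis vector of `F₁`, and
`xc = 0`. Let `ε` be the coordinate function of `e`, which maps `Z` into the maximal ideal, and
let `E` and `D` be the first two differentials of the resolution of `Z`. As `F` is minimal, the
cochain in `Hom(F₄, Z)` with single entry `c` is a cocycle, hence of the form `ψD`, and then `xψ`
is a cocycle, hence of the form `θE`. Lift `ε ∘ ψ`, `ε ∘ θ`, `E` and the relevant column `d` of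
`D` to `S`. In the identity `xy = x(y - ψd) + (xψ - θE)d + θ(Ed)` each summand is then a product
of something in `𝔫` and something in `I`, contradicting `xy ∉ 𝔫I`. So `F` is finite, and the
exactness of `Hom(F, A)` forces a finite minimal resolution to have length zero. -/

open scoped Matrix TensorProduct

section MatrixAction

variable {A : Type*} [CommRing A] {o p q r : Type*} [Fintype p] [Fintype q] [Fintype r]
variable {K L N : Type*} [AddCommGroup K] [Module A K] [AddCommGroup L] [Module A L]
  [AddCommGroup N] [Module A N]

/-- The action of a matrix over `A` on column vectors with entries in an `A`-module. If the matrices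
`d` are the differentials of a complex of free modules `F`, then the action of `d` on vectors over
`N` is the differential of `F ⊗ N` and that of `dᵀ` is the differential of `Hom(F, N)`. -/
def matrixAction (N : Type*) [AddCommGroup N] [Module A N] (P : Matrix o p A) :
    (p → N) →ₗ[A] (o → N) :=
  LinearMap.pi fun i => ∑ k, P i k • LinearMap.proj k

theorem matrixAction_apply (P : Matrix o p A) (v : p → N) (i : o) :
    matrixAction N P v i = ∑ k, P i k • v k := by
  simp [matrixAction]

theorem matrixAction_self (P : Matrix o p A) : matrixAction A P = P.mulVecLin :=
  LinearMap.ext fun v => funext fun i => matrixAction_apply P v i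

theorem matrixAction_zero : matrixAction N (0 : Matrix o p A) = 0 := by
  ext
  simp [matrixAction]

theorem matrixAction_single [DecidableEq p] (P : Matrix o p A) (k : p) (c : N) (i : o) :
    matrixAction N P (Pi.single k c) i = P i k • c := by
  simp [matrixAction_apply, Pi.single_apply]

theorem matrixAction_compLeft (f : K →ₗ[A] L) (P : Matrix o p A) (v : p → K) :
    matrixAction L P (f.compLeft p v) = f.compLeft o (matrixAction K P v) := by
  ext i
  simp [matrixAction_apply]

theorem vecMul_comp (f : N →ₗ[A] A) (v : p → N) (P : Matrix p o A) :
    (f ∘ v) ᵥ* P = f ∘ matrixAction N Pᵀ v := by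
  ext i
  simp [matrixAction_apply, Matrix.vecMul, dotProduct, mul_comm]

theorem matrixAction_transpose_piRing [DecidableEq p] [DecidableEq q] (P : Matrix p q A)
    (f : (p → A) →ₗ[A] N) :
    matrixAction N Pᵀ (LinearEquiv.piRing A N p A f) =
      LinearEquiv.piRing A N q A (f ∘ₗ P.mulVecLin) := by
  ext l
  have hcol : P.col l = ∑ k, P k l • Pi.single k 1 := pi_eq_sum_univ' _
  simp [matrixAction_apply, hcol]

theorem matrixAction_mul (P : Matrix o p A) (Q : Matrix p q A) (v : q → N) :
    matrixAction N (P * Q) v = matrixAction N P (matrixAction N Q v) := by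
  ext i
  simp only [matrixAction_apply, Matrix.mul_apply, Finset.sum_smul, Finset.smul_sum, mul_smul]
  exact Finset.sum_comm

theorem matrixAction_map {B : Type*} [CommRing B] [Algebra A B] [Module B N] [IsScalarTower A B N]
    (P : Matrix o p A) :
    ⇑(matrixAction N (P.map (algebraMap A B))) = matrixAction N P := by
  ext v i
  simp [matrixAction_apply]

theorem matrixAction_pi_apply {ι : Type*} (P : Matrix o p A) (v : p → ι → N) (i : o) (j : ι) :
    matrixAction (ι → N) P v i j = matrixAction N P (fun k => v k j) i := by
  simp [matrixAction_apply]

theorem exact_compLeft {f : K →ₗ[A] L} {g : L →ₗ[A] N} (h : Function.Exact f g) (ι : Type*) :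
    Function.Exact (f.compLeft ι) (g.compLeft ι) := by
  intro v
  simp only [funext_iff, LinearMap.compLeft_apply, Pi.zero_apply, Set.mem_range, h _,
    Function.comp_apply, Classical.skolem]

theorem exact_matrixAction_of_linearEquiv {P : Matrix o p A} {Q : Matrix p q A}
    (h : Function.Exact (matrixAction N Q) (matrixAction N P)) (e : N ≃ₗ[A] K) :
    Function.Exact (matrixAction K Q) (matrixAction K P) :=
  Function.Exact.of_ladder_linearEquiv_of_exact (e₁ := .piCongrRight fun _ => e)
    (e₂ := .piCongrRight fun _ => e) (e₃ := .piCongrRight fun _ => e)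
    (LinearMap.ext fun v => matrixAction_compLeft e.toLinearMap Q v)
    (LinearMap.ext fun v => matrixAction_compLeft e.toLinearMap P v) h

theorem exact_matrixAction_pi {P : Matrix o p A} {Q : Matrix p q A}
    (h : Function.Exact (matrixAction N Q) (matrixAction N P)) (ι : Type*) :
    Function.Exact (matrixAction (ι → N) Q) (matrixAction (ι → N) P) := by
  refine fun v => ⟨fun hv => ?_, ?_⟩
  · choose w hw using fun j => (h fun k => v k j).1
      (funext fun i => (matrixAction_pi_apply P v i j).symm.trans (congrFun₂ hv i j))
    exact ⟨fun l j => w j l,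
      funext₂ fun k j => (matrixAction_pi_apply Q _ k j).trans (congrFun (hw j) k)⟩
  · rintro ⟨w, rfl⟩
    ext i j
    simp only [matrixAction_pi_apply]
    exact congrFun (h.apply_apply_eq_zero fun k => w k j) i

theorem matrixAction_tensorProduct [Fintype o] [DecidableEq o] [DecidableEq p] (B : Type*)
    [AddCommGroup B] [Module A B] (P : Matrix o p A) :
    matrixAction (B ⊗[A] N) P ∘ₗ (TensorProduct.piRight A A B fun _ : p => N).toLinearMap =
      (TensorProduct.piRight A A B fun _ : o => N).toLinearMap ∘ₗ (matrixAction N P).lTensor B := by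
  ext b n i
  simp [matrixAction_apply, TensorProduct.tmul_sum]

theorem matrixAction_tensorProduct_self [Fintype o] [DecidableEq o] [DecidableEq p] (B : Type*)
    [AddCommGroup B] [Module A B] (P : Matrix o p A) :
    matrixAction B P ∘ₗ (TensorProduct.piScalarRight A A B p).toLinearMap =
      (TensorProduct.piScalarRight A A B o).toLinearMap ∘ₗ (matrixAction A P).lTensor B := by
  ext b k i
  simp [matrixAction_apply, Pi.single_apply]

theorem exact_matrixAction_tensorProduct [Finite o] (B : Type*) [AddCommGroup B] [Module A B]
    [Module.Flat A B] {P : Matrix o p A} {Q : Matrix p q A}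
    (h : Function.Exact (matrixAction N Q) (matrixAction N P)) :
    Function.Exact (matrixAction (B ⊗[A] N) Q) (matrixAction (B ⊗[A] N) P) := by
  classical
  have := Fintype.ofFinite o
  exact Function.Exact.of_ladder_linearEquiv_of_exact (matrixAction_tensorProduct B Q)
    (matrixAction_tensorProduct B P) (Module.Flat.lTensor_exact B h)

section ShortExact

variable {P : Matrix o p A} {Q : Matrix p q A} {R : Matrix q r A} {f : K →ₗ[A] L} {g : L →ₗ[A] N}

theorem exact_matrixAction_left_of_shortExact (hf : Function.Injective f)
    (hfg : Function.Exact f g) (hg : Function.Surjective g) (hQR : Q * R = 0)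
    (hN : Function.Exact (matrixAction N R) (matrixAction N Q))
    (hL : Function.Exact (matrixAction L Q) (matrixAction L P)) :
    Function.Exact (matrixAction K Q) (matrixAction K P) := by
  refine fun v => ⟨fun hv => ?_, ?_⟩
  · obtain ⟨w, hw⟩ := (hL (f.compLeft p v)).1 (by rw [matrixAction_compLeft, hv, map_zero])
    obtain ⟨u, hu⟩ := (hN (g.compLeft q w)).1 (by
      rw [matrixAction_compLeft, hw, (exact_compLeft hfg p).apply_apply_eq_zero])
    obtain ⟨u', rfl⟩ : ∃ u', g.compLeft r u' = u := hg.comp_left u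
    obtain ⟨t, ht⟩ := (exact_compLeft hfg q (w - matrixAction L R u')).1 (by
      rw [map_sub, ← hu, matrixAction_compLeft, sub_self])
    refine ⟨t, hf.comp_left (?_ : f.compLeft p _ = f.compLeft p v)⟩
    rw [← matrixAction_compLeft, ht, map_sub, ← matrixAction_mul, hQR, hw, matrixAction_zero,
      LinearMap.zero_apply, sub_zero]
  · rintro ⟨w, rfl⟩
    refine hf.comp_left (?_ : f.compLeft o _ = f.compLeft o 0)
    rw [← matrixAction_compLeft, ← matrixAction_compLeft, hL.apply_apply_eq_zero, map_zero]

theorem exact_matrixAction_right_of_shortExact (hf : Function.Injective f)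
    (hfg : Function.Exact f g) (hg : Function.Surjective g) (hPQ : P * Q = 0)
    (hL : Function.Exact (matrixAction L R) (matrixAction L Q))
    (hK : Function.Exact (matrixAction K Q) (matrixAction K P)) :
    Function.Exact (matrixAction N R) (matrixAction N Q) := by
  refine fun v => ⟨fun hv => ?_, ?_⟩
  · obtain ⟨v', rfl⟩ : ∃ v', g.compLeft q v' = v := hg.comp_left v
    obtain ⟨w, hw⟩ := (exact_compLeft hfg p (matrixAction L Q v')).1 (by
      rw [← matrixAction_compLeft, hv])
    have hKw : matrixAction K P w = 0 := hf.comp_left <| show f.compLeft o _ = f.compLeft o 0 by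
      rw [← matrixAction_compLeft, hw, ← matrixAction_mul, hPQ, matrixAction_zero, map_zero,
        LinearMap.zero_apply]
    obtain ⟨t, rfl⟩ := (hK w).1 hKw
    obtain ⟨u, hu⟩ := (hL (v' - f.compLeft q t)).1 (by
      rw [map_sub, matrixAction_compLeft, hw, sub_self])
    refine ⟨g.compLeft r u, ?_⟩
    rw [matrixAction_compLeft, hu, map_sub, (exact_compLeft hfg q).apply_apply_eq_zero, sub_zero]
  · rintro ⟨w, rfl⟩
    obtain ⟨w', rfl⟩ : ∃ w', g.compLeft r w' = w := hg.comp_left w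
    rw [matrixAction_compLeft, matrixAction_compLeft, hL.apply_apply_eq_zero, map_zero]

end ShortExact

end MatrixAction

/-- A resolution by finite free modules, given by the matrices of its differentials, with entries in
the ideal `𝔞`. Over a local ring with maximal ideal `𝔞` it is a minimal free resolution of the
cokernel of `d 0`. -/
structure MinimalResolution (A : Type*) [CommRing A] (𝔞 : Ideal A) where
  rank : ℕ → ℕ
  d : ∀ n, Matrix (Fin (rank n)) (Fin (rank (n + 1))) A
  mem : ∀ n i j, d n i j ∈ 𝔞
  exact : ∀ n, Function.Exact (d (n + 1)).mulVecLin (d n).mulVecLin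

namespace MinimalResolution

variable {A : Type*} [CommRing A] {𝔞 : Ideal A} (F : MinimalResolution A 𝔞)
variable {K L N : Type*} [AddCommGroup K] [Module A K] [AddCommGroup L] [Module A L]
  [AddCommGroup N] [Module A N]

theorem d_mul_d (n : ℕ) : F.d n * F.d (n + 1) = 0 :=
  Matrix.mulVec_injective <| funext fun v => by
    simpa using (F.exact n).apply_apply_eq_zero v

theorem transpose_d_mul_transpose_d (n : ℕ) : (F.d (n + 1))ᵀ * (F.d n)ᵀ = 0 := by
  rw [← Matrix.transpose_mul, F.d_mul_d, Matrix.transpose_zero]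

/-- The module resolved by `F`. -/
abbrev coker : Type _ := (Fin (F.rank 0) → A) ⧸ LinearMap.range (F.d 0).mulVecLin

/-- The truncated resolution, which resolves the first syzygy. -/
def shift : MinimalResolution A 𝔞 where
  rank n := F.rank (n + 1)
  d n := F.d (n + 1)
  mem n := F.mem (n + 1)
  exact n := F.exact (n + 1)

/-- The complex `Hom(F, N)` is exact in all positive degrees. -/
def HomAcyclic (N : Type*) [AddCommGroup N] [Module A N] : Prop :=
  ∀ j, Function.Exact (matrixAction N (F.d j)ᵀ) (matrixAction N (F.d (j + 1))ᵀ)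

/-- The inclusion of the first syzygy into the free module in degree zero. -/
def syzygyMap : F.shift.coker →ₗ[A] (Fin (F.rank 0) → A) :=
  Submodule.liftQ _ (F.d 0).mulVecLin (F.exact 0).linearMap_ker_eq.ge

theorem syzygyMap_injective : Function.Injective F.syzygyMap :=
  LinearMap.ker_eq_bot.1 (Submodule.ker_liftQ_eq_bot _ _ _ (F.exact 0).linearMap_ker_eq.le)

theorem exact_syzygyMap_mkQ :
    Function.Exact F.syzygyMap (LinearMap.range (F.d 0).mulVecLin).mkQ := by
  rw [LinearMap.exact_iff, Submodule.ker_mkQ]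
  exact (Submodule.range_liftQ _ _ _).symm

theorem syzygyMap_apply_mem (z : F.shift.coker) (i : Fin (F.rank 0)) : F.syzygyMap z i ∈ 𝔞 := by
  obtain ⟨v, rfl⟩ := Submodule.Quotient.mk_surjective _ z
  change ∑ k, F.d 0 i k * v k ∈ 𝔞
  exact Ideal.sum_mem _ fun k _ => 𝔞.mul_mem_right _ (F.mem 0 i k)

theorem exists_syzygyMap_eq_single {s : A} (hs : ∀ a ∈ 𝔞, a * s = 0) (p : Fin (F.rank 1)) :
    ∃ c, F.shift.syzygyMap c = Pi.single p s ∧ ∀ a, a * s = 0 → a • c = 0 := by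
  obtain ⟨v, hv⟩ := (F.exact 0 (Pi.single p s)).1 <| funext fun i => by
    simpa using hs _ (F.mem 0 i p)
  have hc : F.shift.syzygyMap (Submodule.Quotient.mk v) = Pi.single p s := hv
  refine ⟨Submodule.Quotient.mk v, hc, fun a ha => F.shift.syzygyMap_injective ?_⟩
  rw [map_smul, hc, map_zero]
  change a • Pi.single (M := fun _ : Fin (F.rank 1) => A) p s = 0
  rw [← Pi.single_smul, smul_eq_mul, ha, Pi.single_zero]

theorem exact_matrixAction_of_exists_extension
    (h : ∀ f : F.shift.coker →ₗ[A] N, ∃ g : (Fin (F.rank 0) → A) →ₗ[A] N, g ∘ₗ F.syzygyMap = f) :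
    Function.Exact (matrixAction N (F.d 0)ᵀ) (matrixAction N (F.d 1)ᵀ) := by
  refine fun φ => ⟨fun hφ => ?_, ?_⟩
  · obtain ⟨f, rfl⟩ := (LinearEquiv.piRing A N _ A).surjective φ
    rw [matrixAction_transpose_piRing, LinearEquiv.map_eq_zero_iff] at hφ
    obtain ⟨g, hg⟩ := h (Submodule.liftQ _ f (LinearMap.range_le_ker_iff.2 hφ))
    refine ⟨LinearEquiv.piRing A N _ A g, ?_⟩
    rw [matrixAction_transpose_piRing]
    congr 1
    exact LinearMap.ext fun v => LinearMap.congr_fun hg (Submodule.Quotient.mk v)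
  · rintro ⟨ψ, rfl⟩
    rw [← matrixAction_mul, F.transpose_d_mul_transpose_d, matrixAction_zero, LinearMap.zero_apply]

theorem free_of_rank_one_eq_zero (h : F.rank 1 = 0) : Module.Free A F.coker := by
  have : IsEmpty (Fin (F.rank 1)) := h ▸ Fin.isEmpty
  have hbot : LinearMap.range (F.d 0).mulVecLin = ⊥ :=
    LinearMap.range_eq_bot.2 (Subsingleton.elim _ _)
  exact .of_equiv (Submodule.quotEquivOfEqBot _ hbot).symm

section HomAcyclic

variable {F}

theorem HomAcyclic.shift (h : F.HomAcyclic N) : F.shift.HomAcyclic N :=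
  fun j => h (j + 1)

theorem HomAcyclic.of_linearEquiv (h : F.HomAcyclic N) (e : N ≃ₗ[A] K) : F.HomAcyclic K :=
  fun j => exact_matrixAction_of_linearEquiv (h j) e

theorem HomAcyclic.pi (h : F.HomAcyclic N) (ι : Type*) : F.HomAcyclic (ι → N) :=
  fun j => exact_matrixAction_pi (h j) ι

theorem HomAcyclic.tensorProduct (h : F.HomAcyclic N) (B : Type*) [AddCommGroup B] [Module A B]
    [Module.Flat A B] : F.HomAcyclic (B ⊗[A] N) :=
  fun j => exact_matrixAction_tensorProduct B (h j)

variable {f : K →ₗ[A] L} {g : L →ₗ[A] N}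

theorem HomAcyclic.left (hf : Function.Injective f) (hfg : Function.Exact f g)
    (hg : Function.Surjective g) (hN : F.HomAcyclic N) (hL : F.HomAcyclic L) :
    F.shift.HomAcyclic K := fun j =>
  exact_matrixAction_left_of_shortExact hf hfg hg (F.transpose_d_mul_transpose_d j) (hN j)
    (hL (j + 1))

theorem HomAcyclic.right (hf : Function.Injective f) (hfg : Function.Exact f g)
    (hg : Function.Surjective g) (hL : F.HomAcyclic L) (hK : F.HomAcyclic K) :
    F.HomAcyclic N := fun j =>
  exact_matrixAction_right_of_shortExact hf hfg hg (F.transpose_d_mul_transpose_d (j + 1)) (hL j)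
    (hK (j + 1))

theorem HomAcyclic.shift_coker (hF : F.HomAcyclic F.coker) (hA : F.HomAcyclic A) :
    F.shift.HomAcyclic F.shift.coker :=
  .left F.syzygyMap_injective F.exact_syzygyMap_mkQ (Submodule.mkQ_surjective _) hF (hA.pi _)

/-- A nonzero last differential of a finite minimal resolution would have a surjective transpose,
although its entries are in `𝔞`. -/
theorem HomAcyclic.rank_one_eq_zero (hA : F.HomAcyclic A) (h𝔞 : 𝔞 ≠ ⊤) (h : F.rank 2 = 0) :
    F.rank 1 = 0 := by
  by_contra hrank
  let q : Fin (F.rank 1) := ⟨0, Nat.pos_of_ne_zero hrank⟩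
  obtain ⟨w, hw⟩ := (hA 0 (Pi.single q 1)).1 <| funext fun i => (Fin.cast h i).elim0
  refine h𝔞 ((Ideal.eq_top_iff_one _).2 ?_)
  rw [← Pi.single_eq_same (M := fun _ => A) q 1, ← hw, matrixAction_apply]
  exact Ideal.sum_mem _ fun l _ => 𝔞.mul_mem_right _ (F.mem 0 l q)

theorem HomAcyclic.rank_one_eq_zero_of_rank_four (hA : F.HomAcyclic A) (h𝔞 : 𝔞 ≠ ⊤)
    (h : F.rank 4 = 0) : F.rank 1 = 0 :=
  hA.rank_one_eq_zero h𝔞 <| hA.shift.rank_one_eq_zero h𝔞 <|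
    hA.shift.shift.rank_one_eq_zero h𝔞 h

end HomAcyclic

end MinimalResolution

/-- The conclusion of the Auslander-Reiten conjecture for the ring `A` and the modules that have a
minimal resolution with respect to the ideal `𝔞`: if `Ext^j(M, M)` and `Ext^j(M, A)` vanish for all
`j > 0`, then `M` is free. -/
def AuslanderReitenProperty (A : Type*) [CommRing A] (𝔞 : Ideal A) : Prop :=
  ∀ F : MinimalResolution A 𝔞, F.HomAcyclic F.coker → F.HomAcyclic A → F.rank 1 = 0

section BaseChange

variable {A : Type*} [CommRing A] {𝔞 : Ideal A} {B : Type*} [CommRing B] [Algebra A B]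

section Matrix

variable {o p : Type*} [Fintype o] [Fintype p] [DecidableEq o]

theorem map_range_lTensor_mulVecLin (P : Matrix o p A) :
    (LinearMap.range (P.mulVecLin.lTensor B)).map
        (TensorProduct.piScalarRight A A B o).toLinearMap =
      (LinearMap.range (P.map (algebraMap A B)).mulVecLin).restrictScalars A := by
  classical
  rw [← LinearMap.range_comp, ← matrixAction_self, ← matrixAction_tensorProduct_self,
    LinearMap.range_comp_of_range_eq_top _ (LinearEquiv.range _), ← matrixAction_self,
    ← LinearMap.range_restrictScalars]
  congr 1
  exact DFunLike.coe_injective (matrixAction_map _).symm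

/-- Formation of the cokernel of a matrix commutes with base change. -/
noncomputable def tensorProductCokerEquiv (P : Matrix o p A) :
    B ⊗[A] ((o → A) ⧸ LinearMap.range P.mulVecLin) ≃ₗ[A]
      (o → B) ⧸ LinearMap.range (P.map (algebraMap A B)).mulVecLin :=
  (lTensor.equiv B (LinearMap.exact_map_mkQ_range _) (Submodule.mkQ_surjective _)).symm ≪≫ₗ
    Submodule.Quotient.equiv _ _ _ (map_range_lTensor_mulVecLin P) ≪≫ₗ
      Submodule.Quotient.restrictScalarsEquiv A _

end Matrix

namespace MinimalResolution

variable (F : MinimalResolution A 𝔞)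

/-- The base change of a resolution to a ring over which it remains exact. -/
def map (hB : ∀ n, Function.Exact (matrixAction B (F.d (n + 1))) (matrixAction B (F.d n))) :
    MinimalResolution B (𝔞.map (algebraMap A B)) where
  rank := F.rank
  d n := (F.d n).map (algebraMap A B)
  mem n i j := Ideal.mem_map_of_mem _ (F.mem n i j)
  exact n := by
    rw [← matrixAction_self, ← matrixAction_self, matrixAction_map, matrixAction_map]
    exact hB n

theorem homAcyclic_map_iff
    (hB : ∀ n, Function.Exact (matrixAction B (F.d (n + 1))) (matrixAction B (F.d n)))
    {N : Type*} [AddCommGroup N] [Module A N] [Module B N] [IsScalarTower A B N] :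
    (F.map hB).HomAcyclic N ↔ F.HomAcyclic N := by
  refine forall_congr' fun j => ?_
  rw [← matrixAction_map (B := B) (F.d j)ᵀ, ← matrixAction_map (B := B) (F.d (j + 1))ᵀ]
  rfl

theorem rank_one_eq_zero_of_map
    (hB : ∀ n, Function.Exact (matrixAction B (F.d (n + 1))) (matrixAction B (F.d n)))
    (h : AuslanderReitenProperty B (𝔞.map (algebraMap A B)))
    (hF : F.HomAcyclic (B ⊗[A] F.coker)) (hFB : F.HomAcyclic B) : F.rank 1 = 0 :=
  have hF' : (F.map hB).HomAcyclic
      ((Fin (F.rank 0) → B) ⧸ LinearMap.range ((F.d 0).map (algebraMap A B)).mulVecLin) :=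
    (F.homAcyclic_map_iff hB).2 (hF.of_linearEquiv (tensorProductCokerEquiv (F.d 0)))
  h (F.map hB) hF' ((F.homAcyclic_map_iff hB).2 hFB)

end MinimalResolution

theorem AuslanderReitenProperty.of_flat [Module.Flat A B]
    (h : AuslanderReitenProperty B (𝔞.map (algebraMap A B))) : AuslanderReitenProperty A 𝔞 := by
  intro F hF hA
  refine F.rank_one_eq_zero_of_map (fun n => ?_) h (hF.tensorProduct B)
    ((hA.tensorProduct B).of_linearEquiv (TensorProduct.rid A B))
  refine exact_matrixAction_of_linearEquiv (exact_matrixAction_tensorProduct B ?_)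
    (TensorProduct.rid A B)
  simpa only [matrixAction_self] using F.exact n

theorem exact_lsmul_linearMap {x : A} (hx : RingHom.ker (algebraMap A B) = Ideal.span {x}) :
    Function.Exact (LinearMap.lsmul A A x) (Algebra.linearMap A B) := by
  intro a
  rw [Algebra.linearMap_apply, ← RingHom.mem_ker, hx, Ideal.mem_span_singleton']
  simp [mul_comm, eq_comm]

theorem exact_lsmul_tensorProduct_mk (M : Type*) [AddCommGroup M] [Module A M] {x : A}
    (hs : Function.Surjective (algebraMap A B))
    (hx : RingHom.ker (algebraMap A B) = Ideal.span {x}) :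
    Function.Exact (LinearMap.lsmul A M x) (TensorProduct.mk A B M 1) := by
  refine Function.Exact.of_ladder_linearEquiv_of_exact (e₁ := TensorProduct.lid A M)
    (e₂ := TensorProduct.lid A M) (e₃ := .refl A _) ?_ ?_
    (rTensor_exact M (exact_lsmul_linearMap hx) hs)
  · ext
    simp
  · ext
    simp

theorem AuslanderReitenProperty.of_regular (h𝔞 : 𝔞 ≠ ⊤)
    (hs : Function.Surjective (algebraMap A B)) {x : A}
    (hx : RingHom.ker (algebraMap A B) = Ideal.span {x}) (hreg : IsSMulRegular A x)
    (h : AuslanderReitenProperty B (𝔞.map (algebraMap A B))) : AuslanderReitenProperty A 𝔞 := by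
  intro F hF hA
  have hregF : IsSMulRegular F.shift.coker x :=
    .of_injective F.syzygyMap F.syzygyMap_injective (.pi fun _ => hreg)
  have hF' := hF.shift_coker hA
  refine hA.rank_one_eq_zero h𝔞 (F.shift.rank_one_eq_zero_of_map (fun n => ?_) h ?_ ?_)
  · have hex (n : ℕ) : Function.Exact (matrixAction A (F.d (n + 1))) (matrixAction A (F.d n)) := by
      simpa only [matrixAction_self] using F.exact n
    exact exact_matrixAction_right_of_shortExact (f := LinearMap.lsmul A A x) hreg
      (exact_lsmul_linearMap hx) hs (F.d_mul_d n) (hex (n + 1)) (hex n)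
  · exact hF'.right (f := LinearMap.lsmul A _ x) hregF
      (exact_lsmul_tensorProduct_mk F.shift.coker hs hx) (TensorProduct.mk_surjective A _ B hs) hF'
  · exact hA.shift.right (f := LinearMap.lsmul A A x) hreg (exact_lsmul_linearMap hx) hs hA.shift

end BaseChange

section RegularSequence

variable {A : Type*} [CommRing A] {𝔞 : Ideal A}

theorem map_quotient_mk_ne_top {J : Ideal A} (hJ : J ≤ 𝔞) (h𝔞 : 𝔞 ≠ ⊤) :
    𝔞.map (Ideal.Quotient.mk J) ≠ ⊤ := by
  rwa [Ne, Ideal.map_eq_top_iff_of_ker_le _ (by rwa [Ideal.mk_ker])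
    (RingHom.isIntegral_of_surjective _ Ideal.Quotient.mk_surjective)]

theorem AuslanderReitenProperty.of_quotient_sup_span_singleton {J : Ideal A} (hJ : J ≤ 𝔞)
    (h𝔞 : 𝔞 ≠ ⊤) {x : A} (hx : IsSMulRegular (A ⧸ J) x)
    (h : AuslanderReitenProperty (A ⧸ J ⊔ Ideal.span {x})
      (𝔞.map (Ideal.Quotient.mk (J ⊔ Ideal.span {x})))) :
    AuslanderReitenProperty (A ⧸ J) (𝔞.map (Ideal.Quotient.mk J)) := by
  have hle : J ≤ J ⊔ Ideal.span {x} := le_sup_left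
  let _ : Algebra (A ⧸ J) (A ⧸ J ⊔ Ideal.span {x}) := (Ideal.Quotient.factor hle).toAlgebra
  refine .of_regular (B := A ⧸ J ⊔ Ideal.span {x}) (x := Ideal.Quotient.mk J x)
    (map_quotient_mk_ne_top hJ h𝔞) (Ideal.Quotient.factor_surjective hle) ?_ hx ?_
  · rw [RingHom.algebraMap_toAlgebra, Ideal.Quotient.factor_ker, Ideal.map_sup,
      Ideal.map_quotient_self, bot_sup_eq, Ideal.map_span, Set.image_singleton]
  · rwa [Ideal.map_map, RingHom.algebraMap_toAlgebra, Ideal.Quotient.factor_comp_mk]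

theorem AuslanderReitenProperty.of_isWeaklyRegular (h𝔞 : 𝔞 ≠ ⊤) {rs : List A}
    (hrs : RingTheory.Sequence.IsWeaklyRegular A rs) (hmem : ∀ r ∈ rs, r ∈ 𝔞)
    (h : AuslanderReitenProperty (A ⧸ Ideal.ofList rs)
      (𝔞.map (Ideal.Quotient.mk (Ideal.ofList rs)))) :
    AuslanderReitenProperty A 𝔞 := by
  induction rs using List.reverseRecOn with
  | nil =>
    have : Module.Flat A (A ⧸ Ideal.ofList ([] : List A)) :=
      .of_linearEquiv (Submodule.quotEquivOfEqBot _ Ideal.ofList_nil)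
    exact .of_flat h
  | append_singleton rs x ih =>
    rw [RingTheory.Sequence.isWeaklyRegular_append_iff,
      RingTheory.Sequence.isWeaklyRegular_singleton_iff, smul_eq_mul, Ideal.mul_top] at hrs
    rw [Ideal.ofList_append, Ideal.ofList_singleton] at h
    have hmem' : ∀ r ∈ rs, r ∈ 𝔞 := fun r hr => hmem r (List.mem_append_left _ hr)
    exact ih hrs.1 hmem' (.of_quotient_sup_span_singleton (Ideal.span_le.2 hmem') h𝔞 hrs.2 h)

end RegularSequence

section Burch

theorem IsBurchIdeal.exists_mul_notMem {S : Type*} [CommRing S] [IsLocalRing S] {I : Ideal S}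
    (hI : IsBurchIdeal I) : ∃ x ∈ maximalIdeal S, ∃ y : S,
      (∀ z ∈ maximalIdeal S, z * y ∈ I) ∧ x * y ∉ maximalIdeal S * I := by
  by_contra! hcon
  refine hI (le_antisymm (Ideal.mul_mono_right fun i hi => ?_) (Ideal.mul_le.2 fun x hx y hy => ?_))
  · exact Submodule.mem_colon.2 fun z _ => I.mul_mem_right z hi
  · refine hcon x hx y fun z hz => ?_
    simpa only [smul_eq_mul, mul_comm] using Submodule.mem_colon.1 hy z hz

variable {A : Type*} [CommRing A] {𝔞 : Ideal A}

theorem MinimalResolution.HomAcyclic.exists_factorization {F : MinimalResolution A 𝔞}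
    {N : Type*} [AddCommGroup N] [Module A N] (hF : F.HomAcyclic N) (q : Fin (F.rank 2)) {c : N}
    (hc : ∀ a ∈ 𝔞, a • c = 0) {x : A} (hx : x • c = 0) :
    ∃ ψ θ, matrixAction N (F.d 1)ᵀ ψ = Pi.single q c ∧ matrixAction N (F.d 0)ᵀ θ = x • ψ := by
  obtain ⟨ψ, hψ⟩ := (hF 1 (Pi.single q c)).1 <| funext fun i => by
    rw [matrixAction_single]
    exact hc _ (F.mem 2 q i)
  obtain ⟨θ, hθ⟩ := (hF 0 (x • ψ)).1 <| by
    rw [map_smul, hψ, ← Pi.single_smul, hx, Pi.single_zero]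
  exact ⟨ψ, θ, hψ, hθ⟩

variable {S : Type*} [CommRing S] {f : S →+* A}

theorem mul_mem_mul_ker_of_vecMul_eq_smul {ι κ : Type*} [Fintype ι] [Fintype κ] {𝔫 : Ideal S}
    (hf : Function.Surjective f) (h𝔫 : 𝔞.comap f ≤ 𝔫) {x y : S} (hx : x ∈ 𝔫) {d ψ : ι → A}
    {θ : κ → A} {E : Matrix κ ι A} (hd : ∀ i, d i ∈ 𝔞) (hθ : ∀ k, θ k ∈ 𝔞)
    (hψd : ψ ⬝ᵥ d = f y) (hθE : θ ᵥ* E = f x • ψ) (hEd : E *ᵥ d = 0) :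
    x * y ∈ 𝔫 * RingHom.ker f := by
  obtain ⟨d, rfl⟩ : ∃ d', f ∘ d' = d := hf.comp_left d
  obtain ⟨ψ, rfl⟩ : ∃ ψ', f ∘ ψ' = ψ := hf.comp_left ψ
  obtain ⟨θ, rfl⟩ : ∃ θ', f ∘ θ' = θ := hf.comp_left θ
  obtain ⟨E, rfl⟩ : ∃ E' : Matrix κ ι S, E'.map f = E := hf.comp_left.comp_left E
  have hy : y - ψ ⬝ᵥ d ∈ RingHom.ker f := by
    rw [RingHom.mem_ker, map_sub, RingHom.map_dotProduct, hψd, sub_self]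
  have hψ (i : ι) : (x • ψ - θ ᵥ* E) i ∈ RingHom.ker f := by
    rw [RingHom.mem_ker, Pi.sub_apply, map_sub, RingHom.map_vecMul, hθE]
    simp
  have hE (k : κ) : (E *ᵥ d) k ∈ RingHom.ker f := by
    rw [RingHom.mem_ker, RingHom.map_mulVec, hEd, Pi.zero_apply]
  have key : x * y = x * (y - ψ ⬝ᵥ d) + d ⬝ᵥ (x • ψ - θ ᵥ* E) + θ ⬝ᵥ (E *ᵥ d) := by
    rw [dotProduct_sub, Matrix.dotProduct_mulVec, dotProduct_comm d, dotProduct_comm d,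
      smul_dotProduct, smul_eq_mul]
    ring
  rw [key]
  exact add_mem (add_mem (Ideal.mul_mem_mul hx hy)
    (Ideal.sum_mem _ fun i _ => Ideal.mul_mem_mul (h𝔫 (hd i)) (hψ i)))
    (Ideal.sum_mem _ fun k _ => Ideal.mul_mem_mul (h𝔫 (hθ k)) (hE k))

theorem MinimalResolution.HomAcyclic.mul_mem_mul_ker {F : MinimalResolution A 𝔞} {N : Type*}
    [AddCommGroup N] [Module A N] (hF : F.HomAcyclic N) (q : Fin (F.rank 2)) {𝔫 : Ideal S}
    (hf : Function.Surjective f) (h𝔫 : 𝔞.comap f ≤ 𝔫) {x y : S} (hx : x ∈ 𝔫) {c : N}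
    (hc : ∀ a ∈ 𝔞, a • c = 0) (hxc : f x • c = 0) {g : N →ₗ[A] A} (hg : ∀ z, g z ∈ 𝔞)
    (hgc : g c = f y) : x * y ∈ 𝔫 * RingHom.ker f := by
  obtain ⟨ψ, θ, hψ, hθ⟩ := hF.exists_factorization q hc hxc
  have hψd : (g ∘ ψ) ⬝ᵥ (F.d 1).col q = f y := by
    rw [← hgc, ← Pi.single_eq_same (M := fun _ => N) q c, ← hψ]
    exact congrFun (vecMul_comp g ψ (F.d 1)) q
  have hθd : (g ∘ θ) ᵥ* F.d 0 = f x • (g ∘ ψ) := by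
    rw [vecMul_comp, hθ]
    exact funext fun i => map_smul g (f x) (ψ i)
  have hdd : F.d 0 *ᵥ (F.d 1).col q = 0 := congrFun (congrArg Matrix.col (F.d_mul_d 0)) q
  exact mul_mem_mul_ker_of_vecMul_eq_smul hf h𝔫 hx (fun i => F.mem 1 i q) (fun k => hg (θ k))
    hψd hθd hdd

theorem AuslanderReitenProperty.of_isBurchIdeal [IsLocalRing S] (hf : Function.Surjective f)
    (hI : IsBurchIdeal (RingHom.ker f)) (h𝔞 : 𝔞 ≠ ⊤) : AuslanderReitenProperty A 𝔞 := by
  obtain ⟨x, hx, y, hy, hxy⟩ := hI.exists_mul_notMem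
  have h𝔫 : 𝔞.comap f ≤ maximalIdeal S := le_maximalIdeal (Ideal.comap_ne_top f h𝔞)
  have hfy (a : A) (ha : a ∈ 𝔞) : a * f y = 0 := by
    obtain ⟨s, rfl⟩ := hf a
    rw [← map_mul]
    exact hy s (h𝔫 ha)
  intro F hF hA
  by_contra h1
  refine h1 (hA.rank_one_eq_zero_of_rank_four h𝔞 ?_)
  by_contra h4
  let p : Fin (F.rank 1) := ⟨0, Nat.pos_of_ne_zero h1⟩
  let q : Fin (F.rank 4) := ⟨0, Nat.pos_of_ne_zero h4⟩
  obtain ⟨c, hc, hsmul⟩ := F.exists_syzygyMap_eq_single hfy p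
  have hxc : f x • c = 0 := hsmul _ (by rw [← map_mul]; exact hy x hx)
  have hacyclic : F.shift.shift.HomAcyclic F.shift.shift.coker :=
    (hF.shift_coker hA).shift_coker hA.shift
  exact hxy (hacyclic.mul_mem_mul_ker q hf h𝔫 hx (fun a ha => hsmul a (hfy a ha)) hxc
    (g := LinearMap.proj p ∘ₗ F.shift.syzygyMap) (fun z => F.shift.syzygyMap_apply_mem z p)
    ((congrFun hc p).trans (Pi.single_eq_same (M := fun _ : Fin (F.rank 1) => A) p (f y))))

end Burch

section Existence

variable {R : Type*} [CommRing R] [IsLocalRing R]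

theorem exists_surjective_ker_le_maximalIdeal (M : Type*) [AddCommGroup M] [Module R M]
    [Module.Finite R M] : ∃ (n : ℕ) (g : (Fin n → R) →ₗ[R] M),
      Function.Surjective g ∧ ∀ v ∈ LinearMap.ker g, ∀ i, v i ∈ maximalIdeal R := by
  let b := Module.finBasis (ResidueField R) (ResidueField R ⊗[R] M)
  choose m hm using fun i =>
    TensorProduct.mk_surjective R M (ResidueField R) residue_surjective (b i)
  refine ⟨_, Fintype.linearCombination R m, ?_, fun v hv i => ?_⟩
  · rw [← LinearMap.range_eq_top, Fintype.range_linearCombination]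
    exact span_eq_top_of_tmul_eq_basis m b hm
  · have hsum : ∑ i, residue R (v i) • b i = 0 := by
      simp only [← hm]
      simpa [← ResidueField.algebraMap_eq, Fintype.linearCombination_apply, TensorProduct.tmul_sum,
        TensorProduct.tmul_smul] using
        congrArg (TensorProduct.mk R (ResidueField R) M 1) (LinearMap.mem_ker.1 hv)
    exact (residue_eq_zero_iff _).1
      (Fintype.linearIndependent_iff.1 b.linearIndependent _ hsum i)

theorem exists_matrix_range_eq [IsNoetherianRing R] {b : ℕ} (N : Submodule R (Fin b → R)) :
    ∃ (n : ℕ) (D : Matrix (Fin b) (Fin n) R), LinearMap.range D.mulVecLin = N ∧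
      ∀ v ∈ LinearMap.ker D.mulVecLin, ∀ i, v i ∈ maximalIdeal R := by
  obtain ⟨n, g, hg, hker⟩ := exists_surjective_ker_le_maximalIdeal (R := R) N
  refine ⟨n, LinearMap.toMatrix' (N.subtype ∘ₗ g), ?_⟩
  rw [← Matrix.toLin'_apply', Matrix.toLin'_toMatrix', LinearMap.ker_comp_of_ker_eq_bot _
    N.ker_subtype, LinearMap.range_comp_of_range_eq_top _ (LinearMap.range_eq_top.2 hg)]
  exact ⟨N.range_subtype, hker⟩

theorem exists_minimalResolution [IsNoetherianRing R] (M : Type*) [AddCommGroup M] [Module R M]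
    [Module.Finite R M] :
    ∃ F : MinimalResolution R (maximalIdeal R), Nonempty (F.coker ≃ₗ[R] M) := by
  obtain ⟨b, g, hg, hker⟩ := exists_surjective_ker_le_maximalIdeal (R := R) M
  choose n D hrange hmem using fun b => exists_matrix_range_eq (R := R) (b := b)
  let syzygy : ℕ → Σ b, Submodule R (Fin b → R) :=
    Nat.rec ⟨b, LinearMap.ker g⟩ fun _ N => ⟨n N.1 N.2, LinearMap.ker (D N.1 N.2).mulVecLin⟩
  have hsyzygy : ∀ i, ∀ v ∈ (syzygy i).2, ∀ j, v j ∈ maximalIdeal R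
    | 0 => hker
    | i + 1 => hmem (syzygy i).1 (syzygy i).2
  let F : MinimalResolution R (maximalIdeal R) :=
    { rank i := (syzygy i).1
      d i := D (syzygy i).1 (syzygy i).2
      mem i j k := hsyzygy i _
        ((hrange _ _).le ⟨Pi.single k 1, Matrix.mulVec_single_one _ k⟩) j
      exact i := LinearMap.exact_iff.2 (hrange (syzygy (i + 1)).1 (syzygy (i + 1)).2).symm }
  exact ⟨F, ⟨(Submodule.quotEquivOfEq _ _ (hrange b (LinearMap.ker g))).trans
    (g.quotKerEquivOfSurjective hg)⟩⟩

end Existence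

section Ext

open CategoryTheory Abelian

section Contravariant

variable {C : Type*} [Category C] [Abelian C] [HasExt C] {S : ShortComplex C}

theorem subsingleton_ext_of_shortExact (hS : S.ShortExact) [Projective S.X₂] (N : C) (n : ℕ)
    (h : Subsingleton (Ext S.X₃ N (n + 2))) : Subsingleton (Ext S.X₁ N (n + 1)) := by
  refine subsingleton_of_forall_eq 0 fun x => ?_
  obtain ⟨y, rfl⟩ := Ext.contravariant_sequence_exact₁ hS N x (add_comm 1 (n + 1))
    (Subsingleton.elim _ _)
  rw [Ext.eq_zero_of_projective y, Ext.comp_zero]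

theorem exists_comp_eq_of_subsingleton_ext (hS : S.ShortExact) {N : C}
    (h : Subsingleton (Ext S.X₃ N 1)) (φ : S.X₁ ⟶ N) : ∃ ψ : S.X₂ ⟶ N, S.f ≫ ψ = φ := by
  obtain ⟨y, hy⟩ := Ext.contravariant_sequence_exact₁ hS N (Ext.mk₀ φ) (zero_add 1)
    (Subsingleton.elim _ _)
  obtain ⟨ψ, rfl⟩ := Ext.homEquiv₀.symm.surjective y
  refine ⟨ψ, Ext.homEquiv₀.symm.injective ?_⟩
  exact (Ext.mk₀_comp_mk₀ _ _).symm.trans hy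

end Contravariant

section Syzygy

variable {A : Type u} [CommRing A] {𝔞 : Ideal A} (F : MinimalResolution A 𝔞)

/-- The short exact sequence `0 → Ω → A^n → M → 0` given by the first syzygy `Ω` of the module `M`
resolved by `F`. -/
noncomputable def MinimalResolution.syzygyShortComplex : ShortComplex (ModuleCat.{u} A) :=
  .mk (ModuleCat.ofHom F.syzygyMap) (ModuleCat.ofHom (LinearMap.range (F.d 0).mulVecLin).mkQ)
    (ModuleCat.hom_ext F.exact_syzygyMap_mkQ.linearMap_comp_eq_zero)

theorem MinimalResolution.shortExact_syzygyShortComplex : F.syzygyShortComplex.ShortExact :=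
  ModuleCat.shortComplex_shortExact _ F.exact_syzygyMap_mkQ F.syzygyMap_injective
    (Submodule.mkQ_surjective _)

instance MinimalResolution.projective_syzygyShortComplex_X₂ :
    Projective F.syzygyShortComplex.X₂ :=
  inferInstanceAs (Projective (ModuleCat.of A (Fin (F.rank 0) → A)))

theorem MinimalResolution.homAcyclic_of_subsingleton_ext {N : Type u} [AddCommGroup N]
    [Module A N] (h : ∀ j, 0 < j → Subsingleton (Ext (ModuleCat.of A F.coker)
      (ModuleCat.of A N) j)) : F.HomAcyclic N := by
  intro j
  induction j generalizing F with
  | zero =>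
    refine F.exact_matrixAction_of_exists_extension fun f => ?_
    obtain ⟨g, hg⟩ := exists_comp_eq_of_subsingleton_ext F.shortExact_syzygyShortComplex
      (h 1 one_pos) (ModuleCat.ofHom f)
    exact ⟨g.hom, congrArg ModuleCat.Hom.hom hg⟩
  | succ _ ih =>
    refine ih F.shift fun i hi => ?_
    obtain ⟨i, rfl⟩ := Nat.exists_eq_succ_of_ne_zero hi.ne'
    exact subsingleton_ext_of_shortExact F.shortExact_syzygyShortComplex _ i (h (i + 2) (by lia))

end Syzygy

end Ext

section Main

variable {R : Type u} [CommRing R] [IsLocalRing R] [IsNoetherianRing R]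

open CategoryTheory Abelian in
theorem AuslanderReitenProperty.free (hR : AuslanderReitenProperty R (maximalIdeal R))
    (M : Type u) [AddCommGroup M] [Module R M] [Module.Finite R M]
    (hMM : ∀ j, 0 < j → Subsingleton (Ext (ModuleCat.of R M) (ModuleCat.of R M) j))
    (hMR : ∀ j, 0 < j → Subsingleton (Ext (ModuleCat.of R M) (ModuleCat.of R R) j)) :
    Module.Free R M := by
  obtain ⟨F, ⟨e⟩⟩ := exists_minimalResolution (R := R) M
  have acyclic (N : Type u) [AddCommGroup N] [Module R N]
      (hN : ∀ j, 0 < j → Subsingleton (Ext (ModuleCat.of R M) (ModuleCat.of R N) j)) :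
      F.HomAcyclic N := F.homAcyclic_of_subsingleton_ext fun j hj =>
    @Equiv.subsingleton _ _ (((extFunctor j).mapIso e.toModuleIso.op).app
      (ModuleCat.of R N)).addCommGroupIsoToAddEquiv.symm.toEquiv (hN j hj)
  have := F.free_of_rank_one_eq_zero (hR F ((acyclic M hMM).of_linearEquiv e.symm) (acyclic R hMR))
  exact .of_equiv e

theorem IsBurchRing.auslanderReitenProperty (hR : IsBurchRing R) :
    AuslanderReitenProperty R (maximalIdeal R) := by
  obtain ⟨rs, -, hrs, S, _, _, I, hI, ⟨e⟩⟩ := hR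
  have hle : Ideal.ofList rs ≤ maximalIdeal (AdicCompletion (maximalIdeal R) R) :=
    Ideal.span_le.2 fun r hr => hrs.mem_maximalIdeal r hr
  have hne : (maximalIdeal (AdicCompletion (maximalIdeal R) R)).map
      (Ideal.Quotient.mk (Ideal.ofList rs)) ≠ ⊤ :=
    map_quotient_mk_ne_top hle (maximalIdeal.isMaximal _).ne_top
  let f : S →+* (AdicCompletion (maximalIdeal R) R ⧸ Ideal.ofList rs) :=
    (e.symm : (S ⧸ I) →+* _).comp (Ideal.Quotient.mk I)
  have hf : Function.Surjective f := e.symm.surjective.comp Ideal.Quotient.mk_surjective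
  have hker : RingHom.ker f = I := by
    rw [RingHom.ker_comp_of_injective _ e.symm.injective, Ideal.mk_ker]
  have hquotient := AuslanderReitenProperty.of_isBurchIdeal hf (hker.symm ▸ hI) hne
  have hcompletion := AuslanderReitenProperty.of_isWeaklyRegular
    (maximalIdeal.isMaximal _).ne_top hrs.isRegular.toIsWeaklyRegular hrs.mem_maximalIdeal hquotient
  rw [AdicCompletion.maximalIdeal_eq_map] at hcompletion
  exact hcompletion.of_flat

end Main

theorem mainTheorem2_general (R : Type u) [CommRing R] [IsLocalRing R] [IsNoetherianRing R]
    (hBurch : IsBurchRing R)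
    (M : Type u) [AddCommGroup M] [Module R M] [Module.Finite R M]
    (hMM : ∀ j : ℕ, 0 < j →
      Subsingleton (CategoryTheory.Abelian.Ext (ModuleCat.of R M) (ModuleCat.of R M) j))
    (hMR : ∀ j : ℕ, 0 < j →
      Subsingleton (CategoryTheory.Abelian.Ext (ModuleCat.of R M) (ModuleCat.of R R) j)) :
    Module.Free R M :=
  hBurch.auslanderReitenProperty.free M hMM hMR

theorem mainTheorem2 (R : Type u) [CommRing R] [IsLocalRing R] [IsNoetherianRing R]
    (hCM : IsCohenMacaulayLocal R) (hBurch : IsBurchRing R)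
    (M : Type u) [AddCommGroup M] [Module R M] [Module.Finite R M]
    (hMM : ∀ j : ℕ, 0 < j →
      Subsingleton (CategoryTheory.Abelian.Ext (ModuleCat.of R M) (ModuleCat.of R M) j))
    (hMR : ∀ j : ℕ, 0 < j →
      Subsingleton (CategoryTheory.Abelian.Ext (ModuleCat.of R M) (ModuleCat.of R R) j)) :
    Module.Free R M :=
  mainTheorem2_general R hBurch M hMM hMR
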